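/- Let $d\ge 1$ and let $\ell:[0,+\infty]\to[0,+\infty]$ be lower semicontinuous with $\ell(0)>0$ and $\lim_{r\to+\infty}\ell(r)=0$. For $N\ge 2$ put $$c_N(x_1,\dots,x_N)=\frac{2}{N(N-1)}\sum_{1\le i<j\le N}\ell(|x_i-x_j|),\qquad x_1,\dots,x_N\in\mathbb{R}^d .$$ Let $\mathcal M(\mathbb{R}^d)$ be the space of signed (finite) Borel measures on $\mathbb{R}^d$ with the weak* topology induced by the pairing $\langle v,\mu\rangle=\int v\,d\mu$ with $C_0(\mathbb{R}^d)$, the Banach space (sup norm) of continuous functions vanishing at infinity. Define $C_N:\mathcal M(\mathbb{R}^d)\to[0,+\infty]$ by $$C_N(\rho)=\inf\Big\{\int c_N\,dP : P \text{ a Borel probability on } (\mathbb{R}^d)^N \text{ all of whose } N \text{ marginals equal } \rho\Big\}$$ if $\rho$ is a probability measure, and $C_N(\rho)=+\infty$ otherwise. Let $$\overline{C_N}(\rho)=\inf\Big\{\liminf_{n} C_N(\rho_n) : \rho_n \text{ probability measures},\ \rho_n\to\rho \text{ weakly*}\Big\}\qquad(\inf\emptyset=+\infty),$$ and let $M_N=C_N^*$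 be the Legendre–Fenchel conjugate, $M_N(v)=\sup_{\rho\in\mathcal M(\mathbb{R}^d)}\{\langle v,\rho\rangle-C_N(\rho)\}$ for $v\in C_0(\mathbb{R}^d)$. A sequence $F_N:X\to[-\infty,+\infty]$ on a topological space $X$ is said to $\Gamma$-converge to $F$ if $\liminf_N F_N(x_N)\ge F(x)$ whenever $x_N\to x$, and every $x\in X$ admits a sequence $x_N\to x$ with $\limsup_N F_N(x_N)\le F(x)$. **Theorem.** The limits $$M_\infty(v)=\lim_{N\to\infty}M_N(v)\quad(v\in C_0(\mathbb{R}^d)),\qquad C_\infty(\rho)=\lim_{N\to\infty}\overline{C_N}(\rho)\quad(\rho\in\mathcal M(\mathbb{R}^d))$$ exist in $[-\infty,+\infty]$, and $C_\infty=M_\infty^*$, that is, $C_\infty(\rho)=\sup_{v\in C_0(\mathbb{R}^d)}\{\langle v,\rho\rangle-M_\infty(v)\}$ for every $\rho\in\mathcal M(\mathbb{R}^d)$. Moreover, $M_N$ $\Gamma$-converges to $M_\infty$ on $C_0(\mathbb{R}^d)$ with the norm topology, and both $C_N$ and $\overline{C_N}$ $\Gamma$-converge to $C_\infty$ on $\mathcal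 M(\mathbb{R}^d)$ with the weak* topology. -/

import Mathlib

open MeasureTheory Filter Topology
open scoped ENNReal ZeroAtInfty

noncomputable section

namespace MultiMarginal

/-- The Euclidean space `ℝ^d`. -/
abbrev Rd (d : ℕ) : Type := EuclideanSpace ℝ (Fin d)

/-- The space `M(ℝ^d)` of (bounded) signed Borel measures on `ℝ^d`. -/
abbrev Meas (d : ℕ) : Type := SignedMeasure (Rd d)

/-- The duality bracket `⟨v, μ⟩ = ∫ v dμ` between `C₀(ℝ^d)` and `M(ℝ^d)`. -/
def pairing {d : ℕ} (v : C₀(Rd d, ℝ)) (μ : Meas d) : ℝ := ∫ᵛ x, v x ∂<•μ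

/-- The weak* topology on `M(ℝ^d)`: the coarsest topology for which `μ ↦ ⟨v, μ⟩` is continuous
for every `v ∈ C₀(ℝ^d)`. -/
instance weakStarTopology (d : ℕ) : TopologicalSpace (Meas d) :=
  TopologicalSpace.induced (fun (μ : Meas d) (v : C₀(Rd d, ℝ)) => pairing v μ) Pi.topologicalSpace

/-- A probability measure seen as an element of `M(ℝ^d)`. -/
def toMeas {d : ℕ} (ρ : ProbabilityMeasure (Rd d)) : Meas d := (ρ : Measure (Rd d)).toSignedMeasure

/-- Legendre-Fenchel conjugate on `C₀(ℝ^d)` of a functional on `M(ℝ^d)`. -/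
def conjOfMeas {d : ℕ} (F : Meas d → EReal) (v : C₀(Rd d, ℝ)) : EReal :=
  ⨆ μ : Meas d, ((pairing v μ : ℝ) : EReal) - F μ

/-- Legendre-Fenchel conjugate on `M(ℝ^d)` of a functional on `C₀(ℝ^d)`. -/
def conjOfC0 {d : ℕ} (G : C₀(Rd d, ℝ) → EReal) (μ : Meas d) : EReal :=
  ⨆ v : C₀(Rd d, ℝ), ((pairing v μ : ℝ) : EReal) - G v

/-- `Γ`-convergence of a sequence of functionals on a topological space, in the sequential sense. -/
def GammaConverges {X : Type*} [TopologicalSpace X] (F : ℕ → X → EReal) (G : X → EReal) : Prop :=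
  (∀ (x : ℕ → X) (y : X), Tendsto x atTop (𝓝 y) →
    G y ≤ liminf (fun n => F n (x n)) atTop) ∧
  (∀ y : X, ∃ x : ℕ → X, Tendsto x atTop (𝓝 y) ∧
    limsup (fun n => F n (x n)) atTop ≤ G y)

/-- The two-particle interaction cost
`c_N(x_1, …, x_N) = 2 / (N (N - 1)) * ∑_{i < j} ℓ(|x_i - x_j|)` (for `N ≥ 2`). -/
def cost {d : ℕ} (l : ℝ≥0∞ → ℝ≥0∞) (N : ℕ) (x : Fin N → Rd d) : ℝ≥0∞ :=
  2 / ((N : ℝ≥0∞) * ((N : ℝ≥0∞) - 1)) *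
    ∑ i : Fin N, ∑ j ∈ Finset.Ioi i, l (edist (x i) (x j))

/-- `Π_N(ρ)`: the probabilities on `(ℝ^d)^N` all of whose marginals are equal to `ρ`. -/
def plans {d : ℕ} (N : ℕ) (ρ : ProbabilityMeasure (Rd d)) :
    Set (ProbabilityMeasure (Fin N → Rd d)) :=
  {P | ∀ j : Fin N, (P : Measure (Fin N → Rd d)).map (fun x => x j) = (ρ : Measure (Rd d))}

/-- The multi-marginal optimal transport cost of a probability measure. -/
def otCost {d : ℕ} (l : ℝ≥0∞ → ℝ≥0∞) (N : ℕ) (ρ : ProbabilityMeasure (Rd d)) : ℝ≥0∞ :=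
  ⨅ P ∈ plans N ρ, ∫⁻ x, cost l N x ∂(P : Measure (Fin N → Rd d))

/-- The functional `C_N` on `M(ℝ^d)`: the optimal transport cost at a probability measure, and `+∞`
(the infimum of the empty family) at any other signed measure. -/
def CN {d : ℕ} (l : ℝ≥0∞ → ℝ≥0∞) (N : ℕ) (μ : Meas d) : EReal :=
  ⨅ (ρ : ProbabilityMeasure (Rd d)) (_ : toMeas ρ = μ), ((otCost l N ρ : ℝ≥0∞) : EReal)

/-- The relaxed functional: `inf { liminf_n C_N(ρ_n) : ρ_n ⇀ μ weakly*, ρ_n ∈ P(ℝ^d) }`. -/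
def relaxedCN {d : ℕ} (l : ℝ≥0∞ → ℝ≥0∞) (N : ℕ) (μ : Meas d) : EReal :=
  ⨅ (ρ : ℕ → ProbabilityMeasure (Rd d))
    (_ : Tendsto (fun n => toMeas (ρ n)) atTop (𝓝 μ)),
    liminf (fun n => CN l N (toMeas (ρ n))) atTop

/-- `M_N`, the Legendre-Fenchel conjugate of `C_N`. -/
def MN {d : ℕ} (l : ℝ≥0∞ → ℝ≥0∞) (N : ℕ) : C₀(Rd d, ℝ) → EReal := conjOfMeas (CN l N)

/-- `M_∞(v) = lim_N M_N(v)`. -/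
def MInfty {d : ℕ} (l : ℝ≥0∞ → ℝ≥0∞) (v : C₀(Rd d, ℝ)) : EReal :=
  limUnder atTop (fun N : ℕ => MN l N v)

/-- `C_∞(μ)`, the limit as `N → ∞` of the relaxed functionals at `μ`. -/
def CInfty {d : ℕ} (l : ℝ≥0∞ → ℝ≥0∞) (μ : Meas d) : EReal :=
  limUnder atTop (fun N : ℕ => relaxedCN l N μ)

end MultiMarginal

end

/-!
Two facts carry the theorem.

*Monotonicity.* Forgetting one of `N + 1` particles, chosen uniformly, maps plans to plans with the
same marginals and preserves the average two-particle cost (`sum_cost_succAbove`). Hence `C_N` is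
nondecreasing in `N ≥ 2` (`CN_mono`), and so is its relaxation, while the conjugates `M_N` are
nonincreasing; all the limits exist, as `C_∞ = sup_N` of the relaxations and `M_∞ = inf_N M_N`.

*Biduality at fixed `N`.* The relaxation of `C_N` is the conjugate `M_N^*`
(`relaxedCN_eq_conjOfC0`). One inequality is the Fenchel inequality. For the other, the epigraph of
`C_N` seen through finitely many test functions is a convex subset of a finite-dimensional space,
because mixtures of plans are plans; separating its closure from the point given by `μ` and
`M_N^*(μ)` is impossible (`mem_closure_epigraph`). So `μ` is approximated by probability measures
of almost optimal cost on any finite set of test functions. As `C₀(ℝ^d)` is separable and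
probabilities are bounded linear forms, these approximations can be arranged into a weak*
convergent sequence (`exists_recovery_sequence`).

Exchanging two suprema now gives `C_∞ = M_∞^*`. The functions `M_N` are `1`-Lipschitz, so their
pointwise convergence is a `Γ`-convergence. On measures, the `Γ`-liminf inequality is the limit of
the Fenchel inequalities `⟨v, μ_N⟩ - M_N(v) ≤ C_N(μ_N)` followed by a supremum over `v`; the
recovery sequences are constant for the relaxations, and come from `exists_recovery_sequence`,
applied with `N` varying along the sequence, for `C_N` itself.
-/

namespace MultiMarginal


/-! ### The duality bracket -/

section Pairing

variable {d : ℕ}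

lemma integrable_zeroAtInfty (v : C₀(Rd d, ℝ)) (μ : Measure (Rd d)) [IsFiniteMeasure μ] :
    Integrable (fun x => v x) μ :=
  v.toBCF.integrable μ

lemma pairing_toMeas (v : C₀(Rd d, ℝ)) (ρ : ProbabilityMeasure (Rd d)) :
    pairing v (toMeas ρ) = ∫ x, v x ∂(ρ : Measure (Rd d)) :=
  VectorMeasure.integral_toSignedMeasure

/-- Through the Jordan decomposition, the bracket is a difference of two Bochner integrals. -/
lemma pairing_eq_sub (v : C₀(Rd d, ℝ)) (μ : Meas d) :
    pairing v μ = ∫ x, v x ∂μ.toJordanDecomposition.posPart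
      - ∫ x, v x ∂μ.toJordanDecomposition.negPart := by
  conv_lhs => rw [← SignedMeasure.toSignedMeasure_toJordanDecomposition μ]
  rw [pairing, JordanDecomposition.toSignedMeasure, VectorMeasure.integral_sub_vectorMeasure,
    VectorMeasure.integral_toSignedMeasure, VectorMeasure.integral_toSignedMeasure]
  · simpa [VectorMeasure.Integrable, Measure.variation_toSignedMeasure] using
      integrable_zeroAtInfty v _
  · simpa [VectorMeasure.Integrable, Measure.variation_toSignedMeasure] using
      integrable_zeroAtInfty v _

lemma pairing_add (v w : C₀(Rd d, ℝ)) (μ : Meas d) :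
    pairing (v + w) μ = pairing v μ + pairing w μ := by
  simp only [pairing_eq_sub, ZeroAtInftyContinuousMap.add_apply]
  rw [integral_add (integrable_zeroAtInfty v _) (integrable_zeroAtInfty w _),
    integral_add (integrable_zeroAtInfty v _) (integrable_zeroAtInfty w _)]
  ring

lemma pairing_smul (c : ℝ) (v : C₀(Rd d, ℝ)) (μ : Meas d) :
    pairing (c • v) μ = c * pairing v μ := by
  simp only [pairing_eq_sub, ZeroAtInftyContinuousMap.smul_apply, smul_eq_mul,
    integral_const_mul]
  ring

lemma abs_integral_zeroAtInfty_le (v : C₀(Rd d, ℝ)) (μ : Measure (Rd d)) [IsFiniteMeasure μ] :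
    |∫ x, v x ∂μ| ≤ μ.real Set.univ * ‖v‖ :=
  BoundedContinuousFunction.norm_integral_le_mul_norm μ v.toBCF

/-- The duality bracket with a fixed signed measure, as a continuous linear form on `C₀(ℝ^d)`. -/
noncomputable def pairingCLM (μ : Meas d) : C₀(Rd d, ℝ) →L[ℝ] ℝ :=
  LinearMap.mkContinuous
    { toFun := fun v => pairing v μ
      map_add' := fun v w => pairing_add v w μ
      map_smul' := fun c v => pairing_smul c v μ }
    (μ.toJordanDecomposition.posPart.real Set.univ
      + μ.toJordanDecomposition.negPart.real Set.univ)
    (fun v => by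
      change |pairing v μ| ≤ _
      rw [pairing_eq_sub, add_mul]
      exact (abs_sub _ _).trans (add_le_add (abs_integral_zeroAtInfty_le v _)
        (abs_integral_zeroAtInfty_le v _)))

@[simp]
lemma pairingCLM_apply (μ : Meas d) (v : C₀(Rd d, ℝ)) : pairingCLM μ v = pairing v μ := rfl

lemma tendsto_meas_iff {ι : Type*} {L : Filter ι} {f : ι → Meas d} {μ : Meas d} :
    Tendsto f L (𝓝 μ) ↔
      ∀ v : C₀(Rd d, ℝ), Tendsto (fun i => pairing v (f i)) L (𝓝 (pairing v μ)) := by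
  rw [nhds_induced, tendsto_comap_iff, tendsto_pi_nhds]
  rfl

lemma abs_pairing_toMeas_le (v : C₀(Rd d, ℝ)) (ρ : ProbabilityMeasure (Rd d)) :
    |pairing v (toMeas ρ)| ≤ ‖v‖ := by
  rw [pairing_toMeas]
  simpa using abs_integral_zeroAtInfty_le v (ρ : Measure (Rd d))

end Pairing

/-! ### Separability of the space of functions vanishing at infinity -/

/-- A countable dense family is given by the products `χₙ * w`, where `w` runs over a countable
set dense in `C(E, ℝ)` for locally uniform convergence and `χₙ` is a cutoff at radius `n`. -/
theorem separableSpace_zeroAtInfty (E : Type*) [NormedAddCommGroup E] [ProperSpace E] :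
    TopologicalSpace.SeparableSpace C₀(E, ℝ) := by
  let χ : ℕ → E → ℝ := fun n x => max 0 (min 1 (n + 1 - ‖x‖))
  have χ_cont (n : ℕ) : Continuous (χ n) := by fun_prop
  have χ_zero {n : ℕ} {x : E} (hx : (n : ℝ) + 1 ≤ ‖x‖) : χ n x = 0 :=
    max_eq_left ((min_le_right _ _).trans (by linarith))
  have χ_one {n : ℕ} {x : E} (hx : ‖x‖ ≤ n) : χ n x = 1 := by
    have : min (1 : ℝ) (n + 1 - ‖x‖) = 1 := min_eq_left (by linarith)
    simp [χ, this]
  have χ_nonneg (n : ℕ) (x : E) : 0 ≤ χ n x := le_max_left _ _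
  have χ_le (n : ℕ) (x : E) : χ n x ≤ 1 := max_le zero_le_one (min_le_left _ _)
  let T : ℕ × C(E, ℝ) → C₀(E, ℝ) := fun p =>
    { toFun := fun x => χ p.1 x * p.2 x
      continuous_toFun := (χ_cont p.1).mul p.2.continuous
      zero_at_infty' := by
        refine tendsto_const_nhds.congr' ?_
        filter_upwards [(isCompact_closedBall (0 : E) (p.1 + 1)).compl_mem_cocompact] with x hx
        have : (p.1 : ℝ) + 1 ≤ ‖x‖ := by
          simpa using (not_le.1 (by simpa using hx : ¬ ‖x‖ ≤ p.1 + 1)).le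
        rw [χ_zero this, zero_mul] }
  refine ⟨T '' (Set.univ ×ˢ Set.range (TopologicalSpace.denseSeq C(E, ℝ))),
    (Set.countable_univ.prod (Set.countable_range _)).image _, ?_⟩
  rw [Metric.dense_iff]
  intro v r hr
  obtain ⟨ε, hε, hεr⟩ : ∃ ε : ℝ, 0 < ε ∧ 2 * ε < r := ⟨r / 4, by positivity, by linarith⟩
  obtain ⟨n, hn⟩ : ∃ n : ℕ, ∀ x : E, (n : ℝ) < ‖x‖ → |v x| < ε := by
    have h : {x : E | |v x| < ε} ∈ cocompact E := by
      filter_upwards [v.zero_at_infty'.eventually (Metric.ball_mem_nhds (0 : ℝ) hε)] with x hx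
      simpa using hx
    rw [← Metric.cobounded_eq_cocompact, ← comap_norm_atTop, mem_comap] at h
    obtain ⟨t, ht, hts⟩ := h
    obtain ⟨a, ha⟩ := mem_atTop_sets.1 ht
    obtain ⟨n, hn⟩ := exists_nat_ge a
    exact ⟨n, fun x hx => hts (ha _ (hn.trans hx.le))⟩
  let v' : C(E, ℝ) := ⟨v, v.continuous⟩
  have hopen : IsOpen {w : C(E, ℝ) |
      Set.MapsTo (w - v') (Metric.closedBall (0 : E) (n + 1)) (Metric.ball 0 ε)} :=
    (ContinuousMap.isOpen_setOfPred_mapsTo (isCompact_closedBall (0 : E) (n + 1))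
      Metric.isOpen_ball).preimage (continuous_id.sub continuous_const)
  obtain ⟨w, hw, hwD⟩ := (TopologicalSpace.denseRange_denseSeq C(E, ℝ)).inter_open_nonempty _ hopen
    ⟨v', fun x _ => by simpa using hε⟩
  refine ⟨T (n, w), ?_, (n, w), ⟨trivial, hwD⟩, rfl⟩
  rw [Metric.mem_ball, ← ZeroAtInftyContinuousMap.dist_toBCF_eq_dist]
  refine lt_of_le_of_lt ((BoundedContinuousFunction.dist_le (by positivity)).2 fun x => ?_) hεr
  change dist (χ n x * w x) (v x) ≤ 2 * ε
  rw [Real.dist_eq]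
  have key : |χ n x * w x - v x| ≤ χ n x * |w x - v x| + (1 - χ n x) * |v x| := by
    calc |χ n x * w x - v x| = |χ n x * (w x - v x) - (1 - χ n x) * v x| := by ring_nf
      _ ≤ |χ n x * (w x - v x)| + |(1 - χ n x) * v x| := abs_sub _ _
      _ = _ := by
        rw [abs_mul, abs_mul, abs_of_nonneg (χ_nonneg n x),
          abs_of_nonneg (sub_nonneg.2 (χ_le n x))]
  have hfst : χ n x * |w x - v x| ≤ ε := by
    rcases le_total ((n : ℝ) + 1) ‖x‖ with hx | hx
    · rw [χ_zero hx, zero_mul]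
      exact hε.le
    · have : |w x - v x| < ε := by
        simpa [v'] using hw (show x ∈ Metric.closedBall (0 : E) (n + 1) by simpa using hx)
      nlinarith [χ_nonneg n x, χ_le n x, abs_nonneg (w x - v x)]
  have hsnd : (1 - χ n x) * |v x| ≤ ε := by
    rcases le_or_gt ‖x‖ n with hx | hx
    · rw [χ_one hx, sub_self, zero_mul]
      exact hε.le
    · nlinarith [χ_nonneg n x, χ_le n x, abs_nonneg (v x), hn x hx]
  linarith


/-! ### Monotonicity in the number of particles -/

/-- Each pair `i < j` of `Fin (N + 1)` survives the deletion of `k` for the `N - 1` values of `k`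
other than `i` and `j`. -/
lemma sum_succAbove_pairs {N : ℕ} (f : Fin (N + 1) → Fin (N + 1) → ℝ≥0∞) :
    ∑ k : Fin (N + 1), ∑ i : Fin N, ∑ j ∈ Finset.Ioi i, f (k.succAbove i) (k.succAbove j)
      = ((N - 1 : ℕ) : ℝ≥0∞) * ∑ i : Fin (N + 1), ∑ j ∈ Finset.Ioi i, f i j := by
  have ioi (M : ℕ) (i : Fin M) (g : Fin M → ℝ≥0∞) :
      ∑ j ∈ Finset.Ioi i, g j = ∑ j, if i < j then g j else 0 := by
    rw [← Finset.sum_filter]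
    congr 1
    ext j
    simp
  have drop (k : Fin (N + 1)) (g : Fin (N + 1) → ℝ≥0∞) :
      ∑ i : Fin N, g (k.succAbove i) = ∑ i, if i ≠ k then g i else 0 := by
    rw [Fin.sum_univ_succAbove _ k]
    simp
  have lhs (k : Fin (N + 1)) :
      ∑ i : Fin N, ∑ j ∈ Finset.Ioi i, f (k.succAbove i) (k.succAbove j)
        = ∑ i, ∑ j, if i < j then (if k ≠ i ∧ k ≠ j then f i j else 0) else 0 := by
    simp_rw [ioi]
    have step (i : Fin N) :
        (∑ j, if i < j then f (k.succAbove i) (k.succAbove j) else 0)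
          = ∑ j, if j ≠ k then (if k.succAbove i < j then f (k.succAbove i) j else 0) else 0 := by
      rw [← drop k (fun j => if k.succAbove i < j then f (k.succAbove i) j else 0)]
      simp
    simp_rw [step]
    rw [drop k (fun i => ∑ j, if j ≠ k then (if i < j then f i j else 0) else 0)]
    refine Finset.sum_congr rfl fun i _ => ?_
    by_cases hi : i = k
    · simp [hi]
    · rw [if_pos hi]
      refine Finset.sum_congr rfl fun j _ => ?_
      by_cases hj : j = k
      · simp [hj]
      · simp [hj, Ne.symm hj, Ne.symm hi]
  simp_rw [lhs]
  rw [Finset.sum_comm, Finset.mul_sum]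
  refine Finset.sum_congr rfl fun i _ => ?_
  rw [Finset.sum_comm, ioi, Finset.mul_sum]
  refine Finset.sum_congr rfl fun j _ => ?_
  by_cases hij : i < j
  · simp only [hij, if_true]
    rw [← Finset.sum_filter, Finset.sum_const, nsmul_eq_mul]
    congr 2
    have : Finset.univ.filter (fun k => k ≠ i ∧ k ≠ j) = ({i, j} : Finset (Fin (N + 1)))ᶜ := by
      ext k
      simp
    rw [this, Finset.card_compl, Finset.card_pair hij.ne, Fintype.card_fin]
    omega
  · simp [hij]

lemma sum_cost_succAbove {d N : ℕ} (hN : 2 ≤ N) (l : ℝ≥0∞ → ℝ≥0∞) (x : Fin (N + 1) → Rd d) :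
    ∑ k : Fin (N + 1), cost l N (fun i => x (k.succAbove i))
      = ((N + 1 : ℕ) : ℝ≥0∞) * cost l (N + 1) x := by
  simp only [cost]
  rw [← Finset.mul_sum, sum_succAbove_pairs (fun i j => l (edist (x i) (x j))), ← mul_assoc,
    ← mul_assoc]
  congr 1
  obtain ⟨n, rfl⟩ := Nat.exists_eq_add_of_le hN
  have e1 : ((2 + n : ℕ) : ℝ≥0∞) - 1 = ((1 + n : ℕ) : ℝ≥0∞) := by
    rw [← Nat.cast_one (R := ℝ≥0∞), ← ENNReal.natCast_sub]
    congr 1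
    omega
  have e2 : ((2 + n + 1 : ℕ) : ℝ≥0∞) - 1 = ((2 + n : ℕ) : ℝ≥0∞) := by
    rw [← Nat.cast_one (R := ℝ≥0∞), ← ENNReal.natCast_sub]
    congr 1
  have e3 : 2 + n - 1 = 1 + n := by omega
  have h1 : ((1 + n : ℕ) : ℝ≥0∞) ≠ 0 := Nat.cast_ne_zero.2 (by omega)
  have h2 : ((2 + n : ℕ) : ℝ≥0∞) ≠ 0 := Nat.cast_ne_zero.2 (by omega)
  have h3 : ((2 + n + 1 : ℕ) : ℝ≥0∞) ≠ 0 := Nat.cast_ne_zero.2 (by omega)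
  have t (m : ℕ) : (m : ℝ≥0∞) ≠ ∞ := ENNReal.natCast_ne_top m
  rw [e1, e2, e3, div_eq_mul_inv, div_eq_mul_inv, ENNReal.mul_inv (.inl h2) (.inl (t _)),
    ENNReal.mul_inv (.inl h3) (.inl (t _))]
  calc 2 * (((2 + n : ℕ) : ℝ≥0∞)⁻¹ * ((1 + n : ℕ) : ℝ≥0∞)⁻¹) * ((1 + n : ℕ) : ℝ≥0∞)
      = 2 * ((2 + n : ℕ) : ℝ≥0∞)⁻¹ * (((1 + n : ℕ) : ℝ≥0∞)⁻¹ * ((1 + n : ℕ) : ℝ≥0∞)) := by ring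
    _ = 2 * ((2 + n : ℕ) : ℝ≥0∞)⁻¹ *
          (((2 + n + 1 : ℕ) : ℝ≥0∞) * ((2 + n + 1 : ℕ) : ℝ≥0∞)⁻¹) := by
        rw [ENNReal.inv_mul_cancel h1 (t _), ENNReal.mul_inv_cancel h3 (t _)]
    _ = _ := by ring

lemma measurable_cost {d : ℕ} (N : ℕ) {l : ℝ≥0∞ → ℝ≥0∞} (hl : Measurable l) :
    Measurable (cost (d := d) l N) := by
  unfold cost
  refine Measurable.const_mul ?_ _
  refine Finset.measurable_fun_sum _ fun i _ => Finset.measurable_fun_sum _ fun j _ => ?_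
  exact hl.comp ((measurable_pi_apply i).edist (measurable_pi_apply j))

/-- Forgetting one of `N + 1` particles, chosen uniformly, turns an `(N + 1)`-particle plan into
`N`-particle plans whose costs average to the original one. -/
lemma otCost_le_succ {d N : ℕ} (hN : 2 ≤ N) {l : ℝ≥0∞ → ℝ≥0∞} (hl : Measurable l)
    (ρ : ProbabilityMeasure (Rd d)) : otCost l N ρ ≤ otCost l (N + 1) ρ := by
  refine le_iInf₂ fun P hP => ?_
  have hdrop (k : Fin (N + 1)) :
      Measurable (fun (x : Fin (N + 1) → Rd d) (i : Fin N) => x (k.succAbove i)) :=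
    measurable_pi_lambda _ fun i => measurable_pi_apply _
  have hk (k : Fin (N + 1)) : otCost l N ρ ≤
      ∫⁻ x, cost l N (fun i => x (k.succAbove i)) ∂(P : Measure (Fin (N + 1) → Rd d)) := by
    refine (iInf₂_le (P.map (hdrop k).aemeasurable) fun j => ?_).trans_eq ?_
    · rw [ProbabilityMeasure.toMeasure_map, Measure.map_map (measurable_pi_apply j) (hdrop k)]
      exact hP (k.succAbove j)
    · rw [ProbabilityMeasure.toMeasure_map, lintegral_map (measurable_cost N hl) (hdrop k)]
  have h : ((N + 1 : ℕ) : ℝ≥0∞) * otCost l N ρ ≤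
      ((N + 1 : ℕ) : ℝ≥0∞) * ∫⁻ x, cost l (N + 1) x ∂(P : Measure (Fin (N + 1) → Rd d)) := by
    rw [← lintegral_const_mul _ (measurable_cost _ hl)]
    simp_rw [← sum_cost_succAbove hN]
    have hsum := lintegral_finsetSum (μ := (P : Measure (Fin (N + 1) → Rd d))) Finset.univ
      fun k _ => (measurable_cost N hl).comp (hdrop k)
    simp only [Function.comp_apply] at hsum
    rw [hsum]
    calc ((N + 1 : ℕ) : ℝ≥0∞) * otCost l N ρ = ∑ _k : Fin (N + 1), otCost l N ρ := by simp
      _ ≤ _ := Finset.sum_le_sum fun k _ => hk k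
  exact (ENNReal.mul_le_mul_iff_right (Nat.cast_ne_zero.2 N.succ_ne_zero)
    (ENNReal.natCast_ne_top _)).1 h

lemma CN_le_succ {d N : ℕ} (hN : 2 ≤ N) {l : ℝ≥0∞ → ℝ≥0∞} (hl : Measurable l) (μ : Meas d) :
    CN l N μ ≤ CN l (N + 1) μ :=
  iInf₂_mono fun ρ _ => EReal.coe_ennreal_le_coe_ennreal_iff.2 (otCost_le_succ hN hl ρ)

lemma CN_mono {d N K : ℕ} (hN : 2 ≤ N) (hNK : N ≤ K) {l : ℝ≥0∞ → ℝ≥0∞} (hl : Measurable l)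
    (μ : Meas d) : CN l N μ ≤ CN l K μ := by
  induction K, hNK using Nat.le_induction with
  | base => exact le_rfl
  | succ K hK ih => exact ih.trans (CN_le_succ (hN.trans hK) hl μ)

lemma relaxedCN_mono {d N K : ℕ} (hN : 2 ≤ N) (hNK : N ≤ K) {l : ℝ≥0∞ → ℝ≥0∞}
    (hl : Measurable l) (μ : Meas d) : relaxedCN l N μ ≤ relaxedCN l K μ :=
  iInf₂_mono fun _ _ => liminf_le_liminf (Eventually.of_forall fun _ => CN_mono hN hNK hl _)

lemma MN_anti {d N K : ℕ} (hN : 2 ≤ N) (hNK : N ≤ K) {l : ℝ≥0∞ → ℝ≥0∞} (hl : Measurable l)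
    (v : C₀(Rd d, ℝ)) : MN l K v ≤ MN l N v :=
  iSup_mono fun μ => EReal.sub_le_sub le_rfl (CN_mono hN hNK hl μ)


/-! ### Biduality on finitely many test functions -/

section Duality

variable {d N : ℕ} {l : ℝ≥0∞ → ℝ≥0∞}

lemma coe_le_coe_ennreal_iff (a : ℝ) (x : ℝ≥0∞) :
    (a : EReal) ≤ (x : EReal) ↔ ENNReal.ofReal a ≤ x := by
  rw [← EReal.coe_ennreal_le_coe_ennreal_iff, EReal.coe_ennreal_ofReal]
  rcases le_total 0 a with ha | ha
  · rw [max_eq_left ha]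
  · have h0 : (0 : EReal) ≤ x := EReal.coe_ennreal_nonneg x
    simp [max_eq_right ha, h0, (EReal.coe_nonpos.2 ha).trans h0]

/-- The Fenchel inequality. -/
lemma pairing_sub_CN_le_MN (N : ℕ) (l : ℝ≥0∞ → ℝ≥0∞) (v : C₀(Rd d, ℝ)) (μ : Meas d) :
    (pairing v μ : EReal) - CN l N μ ≤ MN l N v :=
  le_iSup (fun μ : Meas d => ((pairing v μ : ℝ) : EReal) - CN l N μ) μ

/-- To bound `M_N(v)` it suffices to test plans of finite cost; the common marginal of a plan then
plays the role of `μ` in the supremum defining the conjugate. -/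
lemma MN_le_of_forall_plan {v : C₀(Rd d, ℝ)} {s : ℝ}
    (h : ∀ ρ : ProbabilityMeasure (Rd d), ∀ P ∈ plans N ρ, ∀ c : ℝ, 0 ≤ c →
      ∫⁻ x, cost l N x ∂(P : Measure (Fin N → Rd d)) ≤ ENNReal.ofReal c →
      pairing v (toMeas ρ) - c ≤ s) :
    MN l N v ≤ s := by
  refine iSup_le fun μ => EReal.sub_le_of_le_add ?_
  have key : ((pairing v μ - s : ℝ) : EReal) ≤ CN l N μ := by
    refine le_iInf₂ fun ρ hρ => (coe_le_coe_ennreal_iff _ _).2 <| le_iInf₂ fun P hP => ?_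
    subst hρ
    by_cases htop : ∫⁻ x, cost l N x ∂(P : Measure (Fin N → Rd d)) = ∞
    · rw [htop]
      exact le_top
    · refine ENNReal.ofReal_le_of_le_toReal ?_
      have := h ρ P hP _ ENNReal.toReal_nonneg (ENNReal.ofReal_toReal htop).ge
      linarith
  calc (pairing v μ : EReal) = (s : EReal) + ((pairing v μ - s : ℝ) : EReal) := by
        rw [← EReal.coe_add]
        congr 1
        ring
    _ ≤ s + CN l N μ := add_le_add le_rfl key

/-- The epigraph of the optimal transport cost seen through finitely many test functions `v i`:
the pairs `((⟨v i, ρ⟩)ᵢ, c)` such that some plan with marginals `ρ` costs at most `c`. -/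
def epigraph {ι : Type*} (l : ℝ≥0∞ → ℝ≥0∞) (N : ℕ) (v : ι → C₀(Rd d, ℝ)) : Set ((ι → ℝ) × ℝ) :=
  {p | ∃ ρ : ProbabilityMeasure (Rd d), ∃ P ∈ plans N ρ, 0 ≤ p.2 ∧
    ∫⁻ x, cost l N x ∂(P : Measure (Fin N → Rd d)) ≤ ENNReal.ofReal p.2 ∧
    ∀ i, p.1 i = pairing (v i) (toMeas ρ)}

/-- The mixture `a • μ + b • ν` of two probability measures. -/
noncomputable def mixture {X : Type*} [MeasurableSpace X] (μ ν : ProbabilityMeasure X) (a b : ℝ)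
    (ha : 0 ≤ a) (hb : 0 ≤ b) (hab : a + b = 1) : ProbabilityMeasure X :=
  ⟨ENNReal.ofReal a • (μ : Measure X) + ENNReal.ofReal b • (ν : Measure X), ⟨by
    simp [← ENNReal.ofReal_add ha hb, hab]⟩⟩

lemma toMeasure_mixture {X : Type*} [MeasurableSpace X] (μ ν : ProbabilityMeasure X) {a b : ℝ}
    (ha : 0 ≤ a) (hb : 0 ≤ b) (hab : a + b = 1) :
    (mixture μ ν a b ha hb hab : Measure X)
      = ENNReal.ofReal a • (μ : Measure X) + ENNReal.ofReal b • (ν : Measure X) := rfl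

lemma convex_epigraph {ι : Type*} (v : ι → C₀(Rd d, ℝ)) : Convex ℝ (epigraph l N v) := by
  rintro ⟨y₁, c₁⟩ ⟨ρ₁, P₁, hP₁, hc₁, hcost₁, hy₁⟩ ⟨y₂, c₂⟩ ⟨ρ₂, P₂, hP₂, hc₂, hcost₂, hy₂⟩
    a b ha hb hab
  simp only at hc₁ hc₂ hcost₁ hcost₂ hy₁ hy₂
  refine ⟨mixture ρ₁ ρ₂ a b ha hb hab, mixture P₁ P₂ a b ha hb hab, fun j => ?_, ?_, ?_,
    fun i => ?_⟩
  · rw [toMeasure_mixture, toMeasure_mixture, Measure.map_add _ _ (measurable_pi_apply j),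
      Measure.map_smul, Measure.map_smul, hP₁ j, hP₂ j]
  · simp only [Prod.smul_mk, Prod.mk_add_mk, smul_eq_mul]
    positivity
  · simp only [Prod.smul_mk, Prod.mk_add_mk, smul_eq_mul]
    rw [toMeasure_mixture, lintegral_add_measure, lintegral_smul_measure, lintegral_smul_measure,
      ENNReal.ofReal_add (by positivity) (by positivity), ENNReal.ofReal_mul ha,
      ENNReal.ofReal_mul hb, smul_eq_mul, smul_eq_mul]
    gcongr
  · simp only [Prod.smul_mk, Prod.mk_add_mk, Pi.add_apply, Pi.smul_apply, smul_eq_mul, hy₁, hy₂,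
      pairing_toMeas]
    rw [toMeasure_mixture,
      integral_add_measure ((integrable_zeroAtInfty _ _).smul_measure ENNReal.ofReal_ne_top)
      ((integrable_zeroAtInfty _ _).smul_measure ENNReal.ofReal_ne_top), integral_smul_measure,
      integral_smul_measure, ENNReal.toReal_ofReal ha, ENNReal.toReal_ofReal hb, smul_eq_mul,
      smul_eq_mul]

/-- A point outside the closed epigraph would be strictly separated from it by a hyperplane. A
non-vertical hyperplane is a test function `v` violating `⟨v, μ⟩ - M_N(v) ≤ m`; a vertical one
violates it after multiplication by a large factor. -/
lemma mem_closure_epigraph {ι : Type*} [Fintype ι] {μ : Meas d} {m : ℝ}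
    (hm : conjOfC0 (MN l N) μ ≤ m) (v : ι → C₀(Rd d, ℝ)) :
    ((fun i => pairing (v i) μ, m) : (ι → ℝ) × ℝ) ∈ closure (epigraph l N v) := by
  classical
  have hdual (w : C₀(Rd d, ℝ)) (s : ℝ) (h : ∀ ρ : ProbabilityMeasure (Rd d), ∀ P ∈ plans N ρ,
      ∀ c : ℝ, 0 ≤ c → ∫⁻ x, cost l N x ∂(P : Measure (Fin N → Rd d)) ≤ ENNReal.ofReal c →
      pairing w (toMeas ρ) - c ≤ s) : pairing w μ - s ≤ m := by
    have h1 : (pairing w μ : EReal) - MN l N w ≤ m :=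
      (le_iSup (fun w : C₀(Rd d, ℝ) => ((pairing w μ : ℝ) : EReal) - MN l N w) w).trans hm
    have h2 : ((pairing w μ - s : ℝ) : EReal) ≤ m := by
      rw [EReal.coe_sub]
      exact (EReal.sub_le_sub le_rfl (MN_le_of_forall_plan h)).trans h1
    exact_mod_cast h2
  by_contra hnot
  obtain ⟨f, u, hfK, hfu⟩ := geometric_hahn_banach_closed_point
    (convex_epigraph v).closure isClosed_closure hnot
  set a : ι → ℝ := fun i => f (Pi.single i 1, 0) with ha
  set b : ℝ := f (0, 1) with hb
  have hf (y : ι → ℝ) (c : ℝ) : f (y, c) = ∑ i, a i * y i + b * c := by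
    have hyc : ((y, c) : (ι → ℝ) × ℝ)
        = ∑ i, y i • ((Pi.single i 1, 0) : (ι → ℝ) × ℝ) + c • ((0, 1) : (ι → ℝ) × ℝ) := by
      ext j
      · simp [Prod.fst_sum, Finset.sum_apply, Pi.single_apply]
      · simp [Prod.snd_sum]
    rw [hyc, map_add, map_sum, map_smul, smul_eq_mul, mul_comm c]
    congr 1
    exact Finset.sum_congr rfl fun i _ => by rw [map_smul, smul_eq_mul, mul_comm]
  set w : C₀(Rd d, ℝ) := ∑ i, a i • v i with hw
  have hwp (ν : Meas d) : pairing w ν = ∑ i, a i * pairing (v i) ν := by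
    rw [← pairingCLM_apply, hw, map_sum]
    exact Finset.sum_congr rfl fun i _ => by rw [map_smul, smul_eq_mul, pairingCLM_apply]
  rw [hf, ← hwp] at hfu
  have hK (ρ : ProbabilityMeasure (Rd d)) (P : ProbabilityMeasure (Fin N → Rd d))
      (hP : P ∈ plans N ρ) (c : ℝ) (hc : 0 ≤ c)
      (hcost : ∫⁻ x, cost l N x ∂(P : Measure (Fin N → Rd d)) ≤ ENNReal.ofReal c) :
      pairing w (toMeas ρ) + b * c < u := by
    have := hfK (fun i => pairing (v i) (toMeas ρ), c)
      (subset_closure ⟨ρ, P, hP, hc, hcost, fun i => rfl⟩)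
    rwa [hf, ← hwp] at this
  rcases lt_trichotomy b 0 with hb0 | hb0 | hb0
  · have hb' : 0 < -b := neg_pos.2 hb0
    -- `b = -1` after normalization: the hyperplane is the graph of an affine minorant.
    have h := hdual ((-b)⁻¹ • w) ((-b)⁻¹ * u) fun ρ P hP c hc hcost => by
      rw [pairing_smul]
      have := mul_le_mul_of_nonneg_left (hK ρ P hP c hc hcost).le (inv_nonneg.2 hb'.le)
      have e : (-b)⁻¹ * (b * c) = -c := by
        rw [inv_neg, neg_mul, inv_mul_cancel_left₀ hb0.ne]
      rw [mul_add, e] at this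
      linarith
    rw [pairing_smul, ← mul_sub, inv_mul_le_iff₀ hb'] at h
    linarith
  · simp only [hb0, zero_mul, add_zero] at hK hfu
    -- The separation involves finite-cost measures only, so it survives scaling by any `t ≥ 0`.
    have hpos : 0 < pairing w μ - u := by linarith
    set t : ℝ := (|m| + 1) / (pairing w μ - u) with ht
    have ht0 : 0 ≤ t := by positivity
    have h := hdual (t • w) (t * u) fun ρ P hP c hc hcost => by
      rw [pairing_smul]
      have := mul_le_mul_of_nonneg_left (hK ρ P hP c hc hcost).le ht0
      linarith
    rw [pairing_smul, ← mul_sub, ht, div_mul_cancel₀ _ hpos.ne'] at h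
    linarith [le_abs_self m]
  · -- The epigraph is upward closed, so `b > 0` leaves no plan of finite cost, and `M_N 0 = ⊥`.
    have h := hdual 0 (-m - 1) fun ρ P hP c hc hcost => by
      exfalso
      obtain ⟨c', hc', hcc'⟩ : ∃ c', c ≤ c' ∧ u - pairing w (toMeas ρ) ≤ b * c' := by
        refine ⟨max c ((u - pairing w (toMeas ρ)) / b), le_max_left _ _, ?_⟩
        rw [mul_comm, ← div_le_iff₀ hb0]
        exact le_max_right _ _
      have := hK ρ P hP c' (hc.trans hc') (hcost.trans (ENNReal.ofReal_le_ofReal hc'))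
      linarith
    rw [← pairingCLM_apply, map_zero] at h
    linarith

/-- On finitely many test functions, `μ` is approximated by a probability measure whose cost
exceeds the biconjugate at `μ` by at most `ε`. -/
lemma exists_probabilityMeasure_approx {ι : Type*} [Fintype ι] {μ : Meas d} {m : ℝ}
    (hm : conjOfC0 (MN l N) μ ≤ m) (v : ι → C₀(Rd d, ℝ)) {ε : ℝ} (hε : 0 < ε) :
    ∃ ρ : ProbabilityMeasure (Rd d),
      (∀ i, |pairing (v i) (toMeas ρ) - pairing (v i) μ| < ε) ∧
      CN l N (toMeas ρ) ≤ ((m + ε : ℝ) : EReal) := by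
  obtain ⟨⟨y, c⟩, ⟨ρ, P, hP, hc, hcost, hy⟩, hdist⟩ :=
    Metric.mem_closure_iff.1 (mem_closure_epigraph hm v) ε hε
  simp only at hc hcost hy
  rw [dist_comm, Prod.dist_eq, max_lt_iff] at hdist
  refine ⟨ρ, fun i => ?_, ?_⟩
  · rw [← hy i, ← Real.dist_eq]
    exact (dist_le_pi_dist y (fun i => pairing (v i) μ) i).trans_lt hdist.1
  · have hcm : c ≤ m + ε := by
      have := (abs_lt.1 (Real.dist_eq c m ▸ hdist.2)).2
      linarith
    calc CN l N (toMeas ρ) ≤ ((otCost l N ρ : ℝ≥0∞) : EReal) := 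
        iInf₂_le (f := fun (ρ' : ProbabilityMeasure (Rd d)) (_ : toMeas ρ' = toMeas ρ) =>
          ((otCost l N ρ' : ℝ≥0∞) : EReal)) ρ rfl
      _ ≤ ((ENNReal.ofReal c : ℝ≥0∞) : EReal) :=
        EReal.coe_ennreal_le_coe_ennreal_iff.2 ((iInf₂_le P hP).trans hcost)
      _ = (c : EReal) := by rw [EReal.coe_ennreal_ofReal, max_eq_left hc]
      _ ≤ _ := EReal.coe_le_coe_iff.2 hcm

end Duality


/-! ### Recovery sequences and the relaxed cost as a biconjugate -/

section Limits

variable {d : ℕ} {l : ℝ≥0∞ → ℝ≥0∞}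

lemma coe_sub_le_comm {a : ℝ} {x y : EReal} (h : (a : EReal) - x ≤ y) : (a : EReal) - y ≤ x := by
  induction x <;> induction y <;> simp_all [← EReal.coe_sub]
  linarith

lemma tendsto_coe_add {a : ℕ → ℝ} {b : ℝ} {G : ℕ → EReal} {g : EReal}
    (ha : Tendsto a atTop (𝓝 b)) (hG : Tendsto G atTop (𝓝 g)) :
    Tendsto (fun n => (a n : EReal) + G n) atTop (𝓝 ((b : EReal) + g)) :=
  (EReal.continuousAt_add (p := ((b : EReal), g)) (.inl (EReal.coe_ne_top b))
    (.inl (EReal.coe_ne_bot b))).tendsto.comp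
    (((continuous_coe_real_ereal.tendsto b).comp ha).prodMk_nhds hG)

/-- Weak* convergence of probability measures can be tested on a dense sequence, since their
brackets are bounded by the norm of the test function. -/
lemma tendsto_toMeas_of_dense {u : ℕ → C₀(Rd d, ℝ)} (hu : DenseRange u) {μ : Meas d}
    {ρ : ℕ → ProbabilityMeasure (Rd d)}
    (h : ∀ n, ∀ i ≤ n, |pairing (u i) (toMeas (ρ n)) - pairing (u i) μ| < 1 / ((n : ℝ) + 1)) :
    Tendsto (fun n => toMeas (ρ n)) atTop (𝓝 μ) := by
  refine tendsto_meas_iff.2 fun w => Metric.tendsto_atTop.2 fun ε hε => ?_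
  set C : ℝ := ‖pairingCLM μ‖
  have hC : 0 ≤ C := norm_nonneg (pairingCLM μ)
  obtain ⟨δ, hδ, hδε⟩ : ∃ δ : ℝ, 0 < δ ∧ (2 + C) * δ = ε :=
    ⟨ε / (2 + C), by positivity, by field_simp⟩
  obtain ⟨i, hi⟩ := hu.exists_dist_lt w hδ
  rw [dist_eq_norm] at hi
  obtain ⟨n₀, hn₀⟩ := exists_nat_one_div_lt hδ
  refine ⟨max i n₀, fun n hn => ?_⟩
  have hsplit (ν : Meas d) : pairing w ν = pairing (w - u i) ν + pairing (u i) ν := by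
    rw [← pairing_add, sub_add_cancel]
  have e1 : |pairing (w - u i) (toMeas (ρ n))| < δ := (abs_pairing_toMeas_le _ _).trans_lt hi
  have e2 : |pairing (w - u i) μ| ≤ C * δ :=
    ((pairingCLM μ).le_opNorm (w - u i)).trans (mul_le_mul_of_nonneg_left hi.le hC)
  have e3 : |pairing (u i) (toMeas (ρ n)) - pairing (u i) μ| < δ := by
    refine (h n i ((le_max_left _ _).trans hn)).trans (lt_of_le_of_lt ?_ hn₀)
    have : (n₀ : ℝ) ≤ n := by exact_mod_cast (le_max_right _ _).trans hn
    gcongr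
  rw [Real.dist_eq, hsplit (toMeas (ρ n)), hsplit μ]
  rw [abs_lt] at e1 e3 ⊢
  rw [abs_le] at e2
  constructor <;> linarith

/-- If all the biconjugates `M_{K n}^*` are at most `m` at `μ`, then `μ` is a weak* limit of
probability measures `ρ n` with `C_{K n}(ρ n)` asymptotically at most `m`. -/
lemma exists_recovery_sequence {K : ℕ → ℕ} {μ : Meas d} {m : ℝ}
    (hm : ∀ n, conjOfC0 (MN l (K n)) μ ≤ m) :
    ∃ ρ : ℕ → ProbabilityMeasure (Rd d), Tendsto (fun n => toMeas (ρ n)) atTop (𝓝 μ) ∧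
      limsup (fun n => CN l (K n) (toMeas (ρ n))) atTop ≤ m := by
  have := separableSpace_zeroAtInfty (Rd d)
  set u := TopologicalSpace.denseSeq C₀(Rd d, ℝ)
  have hex (n : ℕ) := exists_probabilityMeasure_approx (hm n)
    (fun i : Fin (n + 1) => u i) (Nat.one_div_pos_of_nat (α := ℝ) (n := n))
  choose ρ hρ hcost using hex
  refine ⟨ρ, tendsto_toMeas_of_dense (TopologicalSpace.denseRange_denseSeq _)
    fun n i hi => hρ n ⟨i, Nat.lt_succ_of_le hi⟩, ?_⟩
  have hlim : Tendsto (fun n : ℕ => ((m + 1 / ((n : ℝ) + 1) : ℝ) : EReal)) atTop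
      (𝓝 (m : EReal)) := by
    refine (continuous_coe_real_ereal.tendsto m).comp ?_
    simpa using tendsto_const_nhds.add (tendsto_one_div_add_atTop_nhds_zero_nat (𝕜 := ℝ))
  exact (limsup_le_limsup (Eventually.of_forall hcost)).trans hlim.limsup_eq.le

/-- Lower bounds of the form `⟨v, μₙ⟩ - Gₙ` pass to weak* limits. -/
lemma sub_le_liminf_of_tendsto {x : ℕ → Meas d} {μ : Meas d} (hx : Tendsto x atTop (𝓝 μ))
    {v : C₀(Rd d, ℝ)} {G F : ℕ → EReal} {g : EReal} (hG : Tendsto G atTop (𝓝 g))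
    (h : ∀ᶠ n in atTop, (pairing v (x n) : EReal) - G n ≤ F n) :
    (pairing v μ : EReal) - g ≤ liminf F atTop := by
  have hlim : Tendsto (fun n => (pairing v (x n) : EReal) - G n) atTop
      (𝓝 ((pairing v μ : EReal) - g)) := by
    simp only [sub_eq_add_neg]
    exact tendsto_coe_add (tendsto_meas_iff.1 hx v) ((continuous_neg.tendsto g).comp hG)
  exact hlim.liminf_eq.ge.trans (liminf_le_liminf h)

lemma pairing_sub_MN_le_CN (N : ℕ) (l : ℝ≥0∞ → ℝ≥0∞) (v : C₀(Rd d, ℝ)) (μ : Meas d) :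
    (pairing v μ : EReal) - MN l N v ≤ CN l N μ :=
  coe_sub_le_comm (pairing_sub_CN_le_MN N l v μ)

theorem relaxedCN_eq_conjOfC0 (N : ℕ) (l : ℝ≥0∞ → ℝ≥0∞) (μ : Meas d) :
    relaxedCN l N μ = conjOfC0 (MN l N) μ := by
  refine le_antisymm ?_ ?_
  · refine EReal.le_of_forall_lt_iff_le.1 fun m hm => ?_
    obtain ⟨ρ, hρ, hlim⟩ := exists_recovery_sequence (K := fun _ => N) fun _ => hm.le
    exact (iInf₂_le ρ hρ).trans ((liminf_le_limsup).trans hlim)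
  · exact iSup_le fun v => le_iInf₂ fun ρ hρ => sub_le_liminf_of_tendsto hρ tendsto_const_nhds
      (Eventually.of_forall fun n => pairing_sub_MN_le_CN N l v _)

/-! ### The limits as the number of particles goes to infinity -/

lemma tendsto_MInfty (hl : Measurable l) (v : C₀(Rd d, ℝ)) :
    Tendsto (fun N : ℕ => MN l N v) atTop (𝓝 (MInfty l v)) := by
  have hanti : Antitone (fun N : ℕ => MN l (N + 2) v) := fun N K h =>
    MN_anti (Nat.le_add_left 2 N) (Nat.add_le_add_right h 2) hl v
  exact tendsto_nhds_limUnder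
    ⟨_, (tendsto_add_atTop_iff_nat 2).1 (tendsto_atTop_iInf hanti)⟩

lemma tendsto_CInfty (hl : Measurable l) (μ : Meas d) :
    Tendsto (fun N : ℕ => relaxedCN l N μ) atTop (𝓝 (CInfty l μ)) := by
  have hmono : Monotone (fun N : ℕ => relaxedCN l (N + 2) μ) := fun N K h =>
    relaxedCN_mono (Nat.le_add_left 2 N) (Nat.add_le_add_right h 2) hl μ
  exact tendsto_nhds_limUnder
    ⟨_, (tendsto_add_atTop_iff_nat 2).1 (tendsto_atTop_iSup hmono)⟩

lemma MInfty_le_MN {N : ℕ} (hN : 2 ≤ N) (hl : Measurable l) (v : C₀(Rd d, ℝ)) :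
    MInfty l v ≤ MN l N v :=
  le_of_tendsto (tendsto_MInfty hl v)
    (eventually_atTop.2 ⟨N, fun _ hK => MN_anti hN hK hl v⟩)

lemma relaxedCN_le_CInfty {N : ℕ} (hN : 2 ≤ N) (hl : Measurable l) (μ : Meas d) :
    relaxedCN l N μ ≤ CInfty l μ :=
  ge_of_tendsto (tendsto_CInfty hl μ)
    (eventually_atTop.2 ⟨N, fun _ hK => relaxedCN_mono hN hK hl μ⟩)

lemma pairing_sub_MN_le_relaxedCN (N : ℕ) (l : ℝ≥0∞ → ℝ≥0∞) (v : C₀(Rd d, ℝ)) (μ : Meas d) :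
    (pairing v μ : EReal) - MN l N v ≤ relaxedCN l N μ :=
  (relaxedCN_eq_conjOfC0 N l μ).symm ▸
    le_iSup (fun v : C₀(Rd d, ℝ) => ((pairing v μ : ℝ) : EReal) - MN l N v) v

theorem CInfty_eq_conjOfC0 (hl : Measurable l) (μ : Meas d) :
    CInfty l μ = conjOfC0 (MInfty l) μ := by
  refine le_antisymm ?_ (iSup_le fun v => ?_)
  · refine le_of_tendsto (tendsto_CInfty hl μ) (eventually_atTop.2 ⟨2, fun N hN => ?_⟩)
    rw [relaxedCN_eq_conjOfC0]
    exact iSup_mono fun v => EReal.sub_le_sub le_rfl (MInfty_le_MN hN hl v)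
  · rw [← (tendsto_CInfty hl μ).liminf_eq]
    exact sub_le_liminf_of_tendsto tendsto_const_nhds (tendsto_MInfty hl v)
      (Eventually.of_forall fun N => pairing_sub_MN_le_relaxedCN N l v μ)

/-- `M_N` is `1`-Lipschitz: only probability measures contribute to the supremum. -/
lemma MN_le_norm_add (N : ℕ) (l : ℝ≥0∞ → ℝ≥0∞) (v w : C₀(Rd d, ℝ)) :
    MN l N v ≤ (‖v - w‖ : EReal) + MN l N w := by
  refine iSup_le fun μ => ?_
  by_cases hμ : ∃ ρ : ProbabilityMeasure (Rd d), toMeas ρ = μ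
  · obtain ⟨ρ, rfl⟩ := hμ
    have h : pairing v (toMeas ρ) ≤ ‖v - w‖ + pairing w (toMeas ρ) := by
      have e : pairing v (toMeas ρ) = pairing (v - w) (toMeas ρ) + pairing w (toMeas ρ) := by
        rw [← pairing_add, sub_add_cancel]
      rw [e]
      exact add_le_add_left ((le_abs_self _).trans (abs_pairing_toMeas_le _ _)) _
    calc (pairing v (toMeas ρ) : EReal) - CN l N (toMeas ρ)
        ≤ ((‖v - w‖ + pairing w (toMeas ρ) : ℝ) : EReal) - CN l N (toMeas ρ) :=
          EReal.sub_le_sub (EReal.coe_le_coe_iff.2 h) le_rfl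
      _ = (‖v - w‖ : EReal) + ((pairing w (toMeas ρ) : EReal) - CN l N (toMeas ρ)) := by
          rw [EReal.coe_add, sub_eq_add_neg, add_assoc, ← sub_eq_add_neg]
      _ ≤ _ := add_le_add le_rfl (pairing_sub_CN_le_MN N l w _)
  · have : CN l N μ = ⊤ := iInf₂_eq_top.2 fun ρ hρ => (hμ ⟨ρ, hρ⟩).elim
    simp [this]

theorem gammaConverges_MN (hl : Measurable l) :
    GammaConverges (fun N (v : C₀(Rd d, ℝ)) => MN l N v) (MInfty l) := by
  refine ⟨fun x v hx => ?_, fun v =>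
    ⟨fun _ => v, tendsto_const_nhds, (tendsto_MInfty hl v).limsup_eq.le⟩⟩
  have hnorm : Tendsto (fun n => -‖v - x n‖) atTop (𝓝 0) := by
    simpa using (tendsto_const_nhds.sub hx : Tendsto (fun n => v - x n) atTop _).norm.neg
  have hlim : Tendsto (fun n => ((-‖v - x n‖ : ℝ) : EReal) + MN l n v) atTop (𝓝 (MInfty l v)) := by
    simpa using tendsto_coe_add hnorm (tendsto_MInfty hl v)
  refine hlim.liminf_eq.ge.trans (liminf_le_liminf (Eventually.of_forall fun n => ?_))
  calc ((-‖v - x n‖ : ℝ) : EReal) + MN l n v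
      ≤ ((-‖v - x n‖ : ℝ) : EReal) + ((‖v - x n‖ : EReal) + MN l n (x n)) :=
        add_le_add le_rfl (MN_le_norm_add n l v (x n))
    _ = MN l n (x n) := by
        rw [← add_assoc, ← EReal.coe_add, neg_add_cancel, EReal.coe_zero, zero_add]

/-- The `Γ`-liminf inequality holds for any functionals above the Fenchel lower bounds. -/
lemma CInfty_le_liminf (hl : Measurable l) {F : ℕ → Meas d → EReal}
    (hF : ∀ N v μ, (pairing v μ : EReal) - MN l N v ≤ F N μ) {x : ℕ → Meas d} {μ : Meas d}
    (hx : Tendsto x atTop (𝓝 μ)) : CInfty l μ ≤ liminf (fun n => F n (x n)) atTop := by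
  rw [CInfty_eq_conjOfC0 hl]
  exact iSup_le fun v => sub_le_liminf_of_tendsto hx (tendsto_MInfty hl v)
    (Eventually.of_forall fun n => hF n v (x n))

theorem gammaConverges_relaxedCN (hl : Measurable l) :
    GammaConverges (fun N (μ : Meas d) => relaxedCN l N μ) (CInfty l) :=
  ⟨fun _ _ hx => CInfty_le_liminf hl (fun N v μ => pairing_sub_MN_le_relaxedCN N l v μ) hx,
    fun μ => ⟨fun _ => μ, tendsto_const_nhds, (tendsto_CInfty hl μ).limsup_eq.le⟩⟩

theorem gammaConverges_CN (hl : Measurable l) :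
    GammaConverges (fun N (μ : Meas d) => CN l N μ) (CInfty l) := by
  refine ⟨fun _ _ hx => CInfty_le_liminf hl (fun N v μ => pairing_sub_MN_le_CN N l v μ) hx,
    fun μ => ?_⟩
  have hnonneg : 0 ≤ CInfty l μ :=
    le_trans (le_iInf₂ fun ρ _ => le_liminf_of_le (h := Eventually.of_forall fun n =>
      le_iInf₂ fun _ _ => EReal.coe_ennreal_nonneg _)) (relaxedCN_le_CInfty le_rfl hl μ)
  by_cases htop : CInfty l μ = ⊤
  · exact ⟨fun _ => μ, tendsto_const_nhds, htop ▸ le_top⟩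
  obtain ⟨m, hm⟩ : ∃ m : ℝ, CInfty l μ = m :=
    ⟨_, (EReal.coe_toReal htop (EReal.bot_lt_zero.trans_le hnonneg).ne').symm⟩
  -- `max n 2` because monotonicity in the number of particles starts at `2`.
  obtain ⟨ρ, hρ, hlim⟩ := exists_recovery_sequence (l := l) (μ := μ) (m := m)
    (K := fun n => max n 2) fun n => by
      rw [← relaxedCN_eq_conjOfC0, ← hm]
      exact relaxedCN_le_CInfty (le_max_right _ _) hl μ
  refine ⟨fun n => toMeas (ρ n), hρ, ?_⟩
  rw [hm]
  refine (limsup_congr ?_).trans_le hlim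
  filter_upwards [eventually_ge_atTop 2] with n hn
  rw [max_eq_left hn]

end Limits

end MultiMarginal

theorem mainTheorem2 (d : ℕ) (hd : 1 ≤ d) (l : ℝ≥0∞ → ℝ≥0∞)
    (h1 : 0 < l 0) (h2 : LowerSemicontinuous l) (h3 : Tendsto l (𝓝[≠] ∞) (𝓝 0)) :
    -- the limits defining `M_∞` and `C_∞` exist
    (∀ v : C₀(MultiMarginal.Rd d, ℝ),
      Tendsto (fun N : ℕ => MultiMarginal.MN l N v) atTop (𝓝 (MultiMarginal.MInfty l v))) ∧
    (∀ μ : MultiMarginal.Meas d,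
      Tendsto (fun N : ℕ => MultiMarginal.relaxedCN l N μ) atTop
        (𝓝 (MultiMarginal.CInfty l μ))) ∧
    -- duality
    (∀ μ : MultiMarginal.Meas d,
      MultiMarginal.CInfty l μ = MultiMarginal.conjOfC0 (MultiMarginal.MInfty l) μ) ∧
    -- `Γ`-convergence on `C₀(ℝ^d)` with its norm topology
    MultiMarginal.GammaConverges (fun N (v : C₀(MultiMarginal.Rd d, ℝ)) => MultiMarginal.MN l N v)
      (MultiMarginal.MInfty l) ∧
    -- `Γ`-convergence on `M(ℝ^d)` with the weak* topology
    MultiMarginal.GammaConverges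
      (fun N (μ : MultiMarginal.Meas d) => MultiMarginal.CN l N μ) (MultiMarginal.CInfty l) ∧
    MultiMarginal.GammaConverges
      (fun N (μ : MultiMarginal.Meas d) => MultiMarginal.relaxedCN l N μ)
      (MultiMarginal.CInfty l) := by
  exact
    ⟨MultiMarginal.tendsto_MInfty h2.measurable, MultiMarginal.tendsto_CInfty h2.measurable,
      MultiMarginal.CInfty_eq_conjOfC0 h2.measurable, MultiMarginal.gammaConverges_MN h2.measurable,
      MultiMarginal.gammaConverges_CN h2.measurable,
      MultiMarginal.gammaConverges_relaxedCN h2.measurable⟩
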